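/- Let $n\ge 1$, let $X$ be a separable metric space and let $x\in X$. Suppose that * $X$ is $(n-1)$-connected, i.e. path connected with $\pi_k(X,y)$ trivial for all $1\le k\le n-1$ and $y\in X$; * $X$ is locally $(n-1)$-connected, i.e. for every $y\in X$, every neighbourhood $U$ of $y$ contains a neighbourhood $V$ of $y$ such that the inclusion induces the trivial map $\pi_k(V,v)\to\pi_k(U,v)$ for all $0\le k\le n-1$ and all $v\in V$ (for $k=0$: any two points of $V$ are joined by a path in $U$); * $\pi_n(X,x)$ is free, i.e. it is a free group or, if $n\ge 2$, a free abelian group (of any rank). Then $X$ is semilocally $n$-connected at $x$: there is a neighbourhood $V$ of $x$ such that the homomorphism $\pi_n(V,x)\to\pi_n(X,x)$ induced by the inclusion is trivial. -/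

import Mathlib

open scoped Topology

/-- The composite of a generalized loop in `X` at `x` with a continuous map `f : X → Y`,
a generalized loop in `Y` at `f x`. -/
def GenLoop.pushforward {N X Y : Type*} [TopologicalSpace X] [TopologicalSpace Y] {x : X}
    (f : C(X, Y)) (p : GenLoop N X x) : GenLoop N Y (f x) :=
  ⟨f.comp p.1, fun y hy => congrArg f (p.2 y hy)⟩

/-- The map `f_* : π_n(X, x) → π_n(Y, f x)` induced by a continuous map `f : X → Y`. -/
def HomotopyGroup.inducedMap {X Y : Type*} [TopologicalSpace X] [TopologicalSpace Y]
    (n : ℕ) (f : C(X, Y)) (x : X) : HomotopyGroup.Pi n X x → HomotopyGroup.Pi n Y (f x) :=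
  Quotient.map (GenLoop.pushforward f)
    (fun _ _ h => ContinuousMap.HomotopicRel.comp_continuousMap h f)

/-- The map `f_* : π_n(X, x) → π_n(Y, f x)` is trivial: it sends everything to the class of the
constant loop (the neutral element if `n ≥ 1`, the path component of `f x` if `n = 0`). -/
def HomotopyGroup.InducesTrivially {X Y : Type*} [TopologicalSpace X] [TopologicalSpace Y]
    (n : ℕ) (f : C(X, Y)) (x : X) : Prop :=
  ∀ a : HomotopyGroup.Pi n X x,
    HomotopyGroup.inducedMap n f x a =
      Quotient.mk (GenLoop.Homotopic.setoid (Fin n) (f x)) GenLoop.const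

/-- `X` is `m`-connected: path connected, with `π_k(X, x)` trivial for all `1 ≤ k ≤ m` and all
`x`. -/
def IsMConnected (m : ℕ) (X : Type*) [TopologicalSpace X] : Prop :=
  PathConnectedSpace X ∧
    ∀ k : ℕ, 1 ≤ k → k ≤ m → ∀ x : X, Subsingleton (HomotopyGroup.Pi k X x)

/-- `X` is locally `m`-connected: every neighbourhood `U` of a point contains a neighbourhood `V`
of that point such that the inclusion `V → U` induces the trivial map
`π_k(V, v) → π_k(U, v)` for all `0 ≤ k ≤ m` and all base points `v ∈ V`. -/
def IsLocallyMConnected (m : ℕ) (X : Type*) [TopologicalSpace X] : Prop :=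
  ∀ x : X, ∀ U ∈ 𝓝 x, ∃ V ∈ 𝓝 x, ∃ hVU : V ⊆ U,
    ∀ k ≤ m, ∀ v : V, HomotopyGroup.InducesTrivially k (ContinuousMap.inclusion hVU) v

/-- `X` is semilocally `n`-connected at `x`: there is a neighbourhood `V` of `x` such that the
inclusion `V → X` induces the trivial map `π_n(V, x) → π_n(X, x)`. -/
def IsSemilocallyNConnectedAt (n : ℕ) (X : Type*) [TopologicalSpace X] (x : X) : Prop :=
  ∃ V : Set X, ∃ hV : V ∈ 𝓝 x,
    HomotopyGroup.InducesTrivially n (⟨Subtype.val, continuous_subtype_val⟩ : C(V, X))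
      ⟨x, mem_of_mem_nhds hV⟩

/-- A group is free abelian if it is isomorphic to the free abelian group on some set. (A basis
embeds into the group, so the universe of the group is large enough for it.) -/
def IsFreeAbelian.{u} (G : Type u) [Group G] : Prop :=
  ∃ ι : Type u, Nonempty (Additive G ≃+ FreeAbelianGroup ι)

/-! If no neighbourhood works, there are essential loops `f k` at `x` of size tending to 0. Because
they shrink, infinitely nested concatenation yields loops whose classes satisfy `h k = g k * h (k +
1) ^ m k`, with `g k ≠ 1` the class of `f k` and exponents of free choice. In a free or free abelian
group, word length or the ℓ¹ norm satisfies `L a + m ≤ L (a ^ m) + 1` for `a ≠ 1`, `m ≠ 0`. For `m k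
= L (g k) + 2` this makes `L (h k)` decrease strictly forever, which is absurd. -/

/-! ### Root lengths on free and free abelian groups -/

/-- A length function on a group for which proper powers are longer than their roots. -/
structure IsRootLength {G : Type*} [Group G] (L : G → ℕ) : Prop where
  one : L 1 = 0
  inv (a : G) : L a⁻¹ = L a
  mul_le (a b : G) : L (a * b) ≤ L a + L b
  add_le_pow (a : G) (m : ℕ) : a ≠ 1 → m ≠ 0 → L a + m ≤ L (a ^ m) + 1

namespace IsRootLength

variable {G H : Type*} [Group G] [Group H] {L : G → ℕ}

theorem comp (hL : IsRootLength L) (e : H ≃* G) : IsRootLength (fun a => L (e a)) where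
  one := by simp [hL.one]
  inv a := by simp [hL.inv]
  mul_le a b := by simpa using hL.mul_le (e a) (e b)
  add_le_pow a m ha hm := by
    simpa using hL.add_le_pow (e a) m (by simpa using ha) hm

/-- The equations `h k = g k * h (k + 1) ^ m k` with rapidly growing exponents and nontrivial
coefficients have no solution in a group with a root length. -/
theorem not_forall_eq_mul_pow (hL : IsRootLength L) {g h : ℕ → G} (hg : ∀ k, g k ≠ 1) :
    ¬ ∀ k, h k = g k * h (k + 1) ^ (L (g k) + 2) := by
  intro H
  have key (k : ℕ) (hk : h (k + 1) ≠ 1) : L (h (k + 1)) + 1 ≤ L (h k) := by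
    have h1 := hL.add_le_pow (h (k + 1)) (L (g k) + 2) hk (by omega)
    have h2 : h (k + 1) ^ (L (g k) + 2) = (g k)⁻¹ * h k := by rw [H k]; group
    have h3 := hL.mul_le (g k)⁻¹ (h k)
    rw [← h2, hL.inv] at h3
    omega
  -- If `h (k + 1) = 1`, then `h k = g k`; otherwise `key` makes `L (h k)` positive.
  have hne (k : ℕ) : h k ≠ 1 := by
    by_cases hk : h (k + 1) = 1
    · rw [H k, hk]
      simpa using hg k
    · intro h0
      have := key k hk
      rw [h0, hL.one] at this
      omega
  have hdec (k : ℕ) : L (h k) + k ≤ L (h 0) := by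
    induction k with
    | zero => rfl
    | succ k ih =>
      have := key k (hne _)
      omega
  have := hdec (L (h 0) + 1)
  omega

end IsRootLength

theorem FreeGroup.isRootLength_norm {α : Type*} [DecidableEq α] :
    IsRootLength (FreeGroup.norm : FreeGroup α → ℕ) where
  one := FreeGroup.norm_one
  inv _ := FreeGroup.norm_inv_eq
  mul_le := FreeGroup.norm_mul_le
  add_le_pow a m ha hm := by
    -- Write `a = c r c⁻¹` with `r` cyclically reduced: `c rᵐ c⁻¹` is already reduced, so its length
    -- is `2|c| + m|r|`, and `|r| ≥ 1`.
    have hpow : (a ^ m).toWord =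
        FreeGroup.reduceCyclically.conjugator a.toWord ++
          (List.replicate m (FreeGroup.reduceCyclically a.toWord)).flatten ++
          FreeGroup.invRev (FreeGroup.reduceCyclically.conjugator a.toWord) := by
      rw [FreeGroup.toWord_pow,
        FreeGroup.reduceCyclically.reduce_flatten_replicate FreeGroup.isReduced_toWord, if_neg hm]
    have hone := FreeGroup.reduceCyclically.conj_conjugator_reduceCyclically a.toWord
    have hr : (FreeGroup.reduceCyclically a.toWord).length ≠ 0 := by
      intro h0
      rw [List.length_eq_zero_iff] at h0
      apply ha
      rw [← FreeGroup.mk_toWord (x := a), ← hone, h0, List.append_nil, ← FreeGroup.mul_mk,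
        ← FreeGroup.inv_mk, mul_inv_cancel]
    have hone' := congrArg List.length hone
    have hpow' := congrArg List.length hpow
    simp only [List.length_append, FreeGroup.invRev_length, List.length_flatten,
      List.map_replicate, List.sum_replicate, smul_eq_mul] at hone' hpow'
    unfold FreeGroup.norm
    rw [hpow', ← hone']
    obtain ⟨r, hr'⟩ := Nat.exists_eq_succ_of_ne_zero hr
    obtain ⟨s, rfl⟩ := Nat.exists_eq_succ_of_ne_zero hm
    rw [hr']
    simp only [Nat.succ_eq_add_one]
    nlinarith [Nat.zero_le (r * s)]

theorem Finsupp.isRootLength_sum_natAbs {ι : Type*} :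
    IsRootLength (fun a : Multiplicative (ι →₀ ℤ) => (a.toAdd).sum fun _ z => z.natAbs) where
  one := by simp
  inv a := by
    simp only [toAdd_inv]
    rw [Finsupp.sum_neg_index (by simp)]
    simp
  mul_le a b := by
    classical
    simp only [toAdd_mul]
    rw [Finsupp.sum_of_support_subset _ Finsupp.support_add _ (by simp),
      Finsupp.sum_of_support_subset a.toAdd Finset.subset_union_left _ (by simp),
      Finsupp.sum_of_support_subset b.toAdd Finset.subset_union_right _ (by simp),
      ← Finset.sum_add_distrib]
    exact Finset.sum_le_sum fun i _ => Int.natAbs_add_le _ _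
  add_le_pow a m ha hm := by
    have hsum : ((a ^ m).toAdd.sum fun _ z => z.natAbs) =
        m * a.toAdd.sum fun _ z => z.natAbs := by
      rw [toAdd_pow, Finsupp.sum_smul_index' (by simp), Finsupp.sum, Finsupp.sum, Finset.mul_sum]
      simp [Int.natAbs_mul]
    have hpos : (a.toAdd.sum fun _ z => z.natAbs) ≠ 0 := by
      intro h0
      apply ha
      apply Multiplicative.toAdd.injective
      ext i
      by_contra hi
      have := (Finset.sum_eq_zero_iff.mp h0) i (Finsupp.mem_support_iff.mpr hi)
      exact hi (Int.natAbs_eq_zero.mp this)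
    rw [hsum]
    obtain ⟨r, hr⟩ := Nat.exists_eq_succ_of_ne_zero hpos
    obtain ⟨s, rfl⟩ := Nat.exists_eq_succ_of_ne_zero hm
    rw [hr]
    simp only [Nat.succ_eq_add_one]
    nlinarith [Nat.zero_le (r * s)]

theorem IsFreeGroup.exists_isRootLength {G : Type*} [Group G] (h : IsFreeGroup G) :
    ∃ L : G → ℕ, IsRootLength L := by
  classical
  exact ⟨_, FreeGroup.isRootLength_norm.comp (IsFreeGroup.toFreeGroup G)⟩

theorem IsFreeAbelian.exists_isRootLength {G : Type*} [Group G] (h : IsFreeAbelian G) :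
    ∃ L : G → ℕ, IsRootLength L := by
  obtain ⟨ι, ⟨e⟩⟩ := h
  let e' : G ≃* Multiplicative (ι →₀ ℤ) :=
    AddEquiv.toMultiplicativeRight (e.trans (FreeAbelianGroup.equivFinsupp ι))
  exact ⟨_, Finsupp.isRootLength_sum_natAbs.comp e'⟩

/-! ### Infinitely nested concatenation of loops -/

namespace GenLoop

open Filter

variable {N X : Type*}

section HomotopyClass

variable [TopologicalSpace X] {x : X}

/-- The class of a generalized loop in the homotopy group. -/
def homotopyClass (l : GenLoop N X x) : HomotopyGroup N X x :=
  Quotient.mk (Homotopic.setoid N x) l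

variable [DecidableEq N] [Nonempty N]

theorem homotopyClass_const : homotopyClass (const : GenLoop N X x) = 1 :=
  HomotopyGroup.one_def.symm

theorem homotopyClass_transAt (i : N) (p q : GenLoop N X x) :
    homotopyClass (transAt i p q) = homotopyClass q * homotopyClass p :=
  HomotopyGroup.mul_spec.symm

end HomotopyClass

section Pattern

variable [TopologicalSpace X] {x : X}

/-- An operator on generalized loops which, at each point of the cube, either takes a fixed value
in `S` or evaluates its argument at a fixed point. -/
def IsPattern (S : Set X) (P : GenLoop N X x → GenLoop N X x) : Prop :=
  ∀ t, (∃ c ∈ S, ∀ l, P l t = c) ∨ ∃ s, ∀ l, P l t = l s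

theorem isPattern_id {S : Set X} : IsPattern S (id : GenLoop N X x → GenLoop N X x) :=
  fun t => Or.inr ⟨t, fun _ => rfl⟩

theorem isPattern_const {S : Set X} {f : GenLoop N X x} (hf : ∀ t, f t ∈ S) :
    IsPattern S (fun _ : GenLoop N X x => f) :=
  fun t => Or.inl ⟨f t, hf t, fun _ => rfl⟩

variable [DecidableEq N]

theorem IsPattern.transAt {S : Set X} {P Q : GenLoop N X x → GenLoop N X x}
    (hP : IsPattern S P) (hQ : IsPattern S Q) (i : N) :
    IsPattern S (fun l => GenLoop.transAt i (P l) (Q l)) := by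
  intro t
  simp only [GenLoop.transAt, GenLoop.coe_copy]
  split_ifs
  · exact hP _
  · exact hQ _

/-- The `m`-fold concatenation of a generalized loop with itself along the `i`th coordinate. -/
noncomputable def powAt (i : N) (l : GenLoop N X x) : ℕ → GenLoop N X x
  | 0 => const
  | m + 1 => transAt i l (powAt i l m)

theorem isPattern_powAt {S : Set X} (hx : x ∈ S) (i : N) (m : ℕ) :
    IsPattern S (fun l : GenLoop N X x => powAt i l m) := by
  induction m with
  | zero => exact isPattern_const fun _ => hx
  | succ m ih => exact isPattern_id.transAt ih i

theorem homotopyClass_powAt [Nonempty N] (i : N) (l : GenLoop N X x) (m : ℕ) :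
    homotopyClass (powAt i l m) = homotopyClass l ^ m := by
  induction m with
  | zero => rw [powAt, homotopyClass_const, pow_zero]
  | succ m ih => rw [pow_succ, ← ih, powAt, homotopyClass_transAt]

/-- The finite stages of the infinite nested substitution of the operators `P k`. -/
def iteratePattern (P : ℕ → GenLoop N X x → GenLoop N X x) : ℕ → ℕ → GenLoop N X x
  | 0, _ => const
  | M + 1, k => P k (iteratePattern P M (k + 1))

end Pattern

variable [MetricSpace X] {x : X} {ε : ℕ → ℝ} {P : ℕ → GenLoop N X x → GenLoop N X x}

theorem dist_iteratePattern_base_le (hε : Antitone ε) (hε0 : ∀ k, 0 ≤ ε k)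
    (hP : ∀ k, IsPattern (Metric.closedBall x (ε k)) (P k)) (M k : ℕ) (t) :
    dist (iteratePattern P M k t) x ≤ ε k := by
  induction M generalizing k t with
  | zero => simpa [iteratePattern] using hε0 k
  | succ M ih =>
    rcases hP k t with ⟨c, hc, h⟩ | ⟨s, h⟩
    · rw [iteratePattern, h]
      exact hc
    · rw [iteratePattern, h]
      exact (ih _ _).trans (hε k.le_succ)

/-- The two stages agree down to depth `M`, where one is constant at `x` and the other stays within
`ε (k + M)` of `x`. -/
theorem dist_iteratePattern_le (hε : Antitone ε) (hε0 : ∀ k, 0 ≤ ε k)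
    (hP : ∀ k, IsPattern (Metric.closedBall x (ε k)) (P k)) (M M' k : ℕ) (t) :
    dist (iteratePattern P (M + M') k t) (iteratePattern P M k t) ≤ ε (k + M) := by
  induction M generalizing k t with
  | zero => simpa [iteratePattern] using dist_iteratePattern_base_le hε hε0 hP M' k t
  | succ M ih =>
    rw [Nat.add_right_comm, iteratePattern, iteratePattern]
    rcases hP k t with ⟨c, -, h⟩ | ⟨s, h⟩
    · rw [h, h, dist_self]
      exact hε0 _
    · rw [h, h]
      exact (ih _ _).trans_eq (congrArg ε (by omega))

/-- A value other than `x` was prescribed before the innermost constant loop was reached, so deeper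
nesting cannot change it. Hence pointwise limits exist without completeness. -/
theorem iteratePattern_succ_eq {S : ℕ → Set X} (hP : ∀ k, IsPattern (S k) (P k)) (M k : ℕ) (t)
    (ht : iteratePattern P M k t ≠ x) :
    iteratePattern P (M + 1) k t = iteratePattern P M k t := by
  induction M generalizing k t with
  | zero => exact absurd rfl ht
  | succ M ih =>
    change P k (iteratePattern P M (k + 1)) t ≠ x at ht
    change P k (iteratePattern P (M + 1) (k + 1)) t = P k (iteratePattern P M (k + 1)) t
    rcases hP k t with ⟨c, -, h⟩ | ⟨s, h⟩
    · rw [h, h]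
    · rw [h] at ht
      rw [h, h, ih _ _ ht]

theorem exists_tendsto_iteratePattern {S : ℕ → Set X} (hP : ∀ k, IsPattern (S k) (P k)) (k : ℕ)
    (t) : ∃ y, Tendsto (fun M => iteratePattern P M k t) atTop (𝓝 y) := by
  by_cases h : ∀ M, iteratePattern P M k t = x
  · exact ⟨x, by simp [h]⟩
  · push Not at h
    obtain ⟨M, hM⟩ := h
    refine ⟨iteratePattern P M k t, tendsto_const_nhds.congr' ?_⟩
    filter_upwards [eventually_ge_atTop M] with M' hM'
    induction M', hM' using Nat.le_induction with
    | base => rfl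
    | succ M' _ ih => rw [iteratePattern_succ_eq hP M' k t (ih ▸ hM), ih]

/-- Infinitely nested substitution: operators which prescribe smaller and smaller loops around the
base point have a compatible sequence of loops. -/
theorem exists_forall_eq_pattern (hε : Antitone ε) (hε0 : ∀ k, 0 ≤ ε k)
    (hlim : Tendsto ε atTop (𝓝 0)) (hP : ∀ k, IsPattern (Metric.closedBall x (ε k)) (P k)) :
    ∃ l : ℕ → GenLoop N X x, ∀ k, l k = P k (l (k + 1)) := by
  choose F hF using fun k t => exists_tendsto_iteratePattern hP k t
  have hcont (k : ℕ) : Continuous (F k) := by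
    have hu : TendstoUniformly (fun M t => iteratePattern P M k t) (F k) atTop := by
      rw [Metric.tendstoUniformly_iff]
      intro δ hδ
      have hshift : Tendsto (fun M => ε (k + M)) atTop (𝓝 0) :=
        hlim.comp (tendsto_add_atTop_nat k |>.congr fun M => add_comm _ _)
      filter_upwards [hshift.eventually_lt_const hδ] with M hM t
      refine lt_of_le_of_lt (le_of_tendsto (((hF k t).comp (tendsto_add_atTop_nat M)).dist
        tendsto_const_nhds) (Eventually.of_forall fun M' => ?_)) hM
      rw [Function.comp_apply, add_comm]
      exact dist_iteratePattern_le hε hε0 hP M M' k t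
    exact hu.continuous (Frequently.of_forall fun M => (iteratePattern P M k).1.continuous)
  refine ⟨fun k => ⟨⟨F k, hcont k⟩, fun t ht => ?_⟩, fun k => ?_⟩
  · refine tendsto_nhds_unique (hF k t) (tendsto_const_nhds.congr fun M => ?_)
    exact ((iteratePattern P M k).2 t ht).symm
  · ext t
    have hs := (hF k t).comp (tendsto_add_atTop_nat 1)
    rcases hP k t with ⟨c, -, h⟩ | ⟨s, h⟩
    · rw [h]
      refine tendsto_nhds_unique hs (tendsto_const_nhds.congr fun M => ?_)
      exact (h _).symm
    · rw [h]
      refine tendsto_nhds_unique hs ((hF (k + 1) s).congr fun M => ?_)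
      exact (h _).symm

/-- A sequence of generalized loops shrinking to the base point of a space whose homotopy group
has a root length contains a null-homotopic one. -/
theorem exists_homotopyClass_eq_one_of_isRootLength [DecidableEq N] [Nonempty N]
    {L : HomotopyGroup N X x → ℕ} (hL : IsRootLength L) (hε : Antitone ε) (hε0 : ∀ k, 0 ≤ ε k)
    (hlim : Tendsto ε atTop (𝓝 0)) (f : ℕ → GenLoop N X x)
    (hf : ∀ k t, dist (f k t) x ≤ ε k) :
    ∃ k, homotopyClass (f k) = 1 := by
  by_contra! hne
  let i : N := Classical.arbitrary N
  obtain ⟨l, hl⟩ := exists_forall_eq_pattern hε hε0 hlim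
    -- `f k` stands second because `transAt` reverses the order of the product.
    (P := fun k l => transAt i (powAt i l (L (homotopyClass (f k)) + 2)) (f k)) fun k =>
      (isPattern_powAt (Metric.mem_closedBall_self (hε0 k)) i _).transAt (isPattern_const (hf k)) i
  refine hL.not_forall_eq_mul_pow (h := fun k => homotopyClass (l k)) hne fun k => ?_
  rw [← homotopyClass_powAt i, ← homotopyClass_transAt, ← hl]

end GenLoop

/-! ### Semilocal connectedness -/

theorem isSemilocallyNConnectedAt_of_isRootLength {X : Type*} [MetricSpace X] (n : ℕ) [NeZero n]
    (x : X) {L : HomotopyGroup.Pi n X x → ℕ} (hL : IsRootLength L) :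
    IsSemilocallyNConnectedAt n X x := by
  by_contra hcon
  have hloop (k : ℕ) : ∃ f : GenLoop (Fin n) X x,
      (∀ t, dist (f t) x ≤ 1 / ((k : ℝ) + 1)) ∧
        GenLoop.homotopyClass f ≠ 1 := by
    by_contra! hk
    refine hcon ⟨Metric.closedBall x (1 / ((k : ℝ) + 1)),
      Metric.closedBall_mem_nhds x (by positivity), fun a => ?_⟩
    induction a using Quotient.inductionOn with
    | h p => exact hk (GenLoop.pushforward (x := ⟨x, Metric.mem_closedBall_self (by positivity)⟩)
        (⟨Subtype.val, continuous_subtype_val⟩ :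
          C(Metric.closedBall x (1 / ((k : ℝ) + 1)), X)) p) fun t => (p t).2
  choose f hf hne using hloop
  obtain ⟨k, hk⟩ := GenLoop.exists_homotopyClass_eq_one_of_isRootLength hL
    (ε := fun k : ℕ => 1 / ((k : ℝ) + 1))
    (fun a b hab => one_div_le_one_div_of_le (by positivity) (by gcongr))
    (fun k => by positivity) tendsto_one_div_add_atTop_nhds_zero_nat f hf
  exact hne k hk

theorem proposition3p12 {X : Type*} [MetricSpace X] [TopologicalSpace.SeparableSpace X]
    (n : ℕ) [NeZero n] (x : X)
    (hconn : IsMConnected (n - 1) X) (hloc : IsLocallyMConnected (n - 1) X)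
    (hfree : IsFreeGroup (HomotopyGroup.Pi n X x) ∨
      2 ≤ n ∧ IsFreeAbelian (HomotopyGroup.Pi n X x)) :
    IsSemilocallyNConnectedAt n X x := by
  obtain ⟨L, hL⟩ : ∃ L : HomotopyGroup.Pi n X x → ℕ, IsRootLength L :=
    hfree.elim IsFreeGroup.exists_isRootLength fun h => h.2.exists_isRootLength
  exact isSemilocallyNConnectedAt_of_isRootLength n x hL
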